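/- Let $L$ be a lattice of rank $n\ge 1$ with dual lattice $L^*=\mathrm{Hom}(L,\mathbb Z)$, and let $\Delta=(\Sigma,C,w^\pm)$ be an $n$-dimensional simplicial multi-fan in $L$. That is, $\Sigma$ is a finite simplicial complex (including the empty simplex); $\Sigma^{(k)}$ denotes the set of its simplices with $k$ vertices, where $\Sigma^{(n)}\neq\emptyset$ and $\Sigma^{(k)}=\emptyset$ for $k>n$; $C$ assigns to each $I\in\Sigma^{(k)}$ a $k$-dimensional rational simplicial cone $C(I)\subset L_{\mathbb R}=L\otimes\mathbb R$ such that $J\mapsto C(J)$ is a bijection from the faces of $I$ to the faces of $C(I)$; and $w^\pm$ are functions $\Sigma^{(n)}\to\mathbb Z_{\ge 0}$, with $w=w^+-w^-$. Suppose that $\Delta$ is complete: for every $K\in\Sigma$, writing $C_K(J)$ for the image of $C(J)$ in $L_{\mathbb R}/\mathrm{span}\,C(K)$, the integer $\sum_{J\in\Sigma^{(n)},\ J\supset K,\ v\in C_K(J)}w(J)$ is the same for all generic $v\in L_{\mathbb R}/\mathrm{span}\,C(K)$, where $v$ is generic if it lies in no subspace spanned by a cone $C_K(J)$ with $K\subset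 J\in\Sigma$ and $|J|<n$. For each vertex $i$ let $v_i\in L$ be the primitive vector generating the ray $C(\{i\})$, and suppose that $\Delta$ is non-singular: for every $I\in\Sigma^{(n)}$ the family $\{v_i\}_{i\in I}$ is a basis of $L$. Let $\{u_i^I\}_{i\in I}$ be the dual basis of $L^*$. The $T_y$-genus of $\Delta$ is $$T_y[\Delta]=\sum_{I\in\Sigma^{(n)}}w(I)\prod_{i\in I}\frac{1+y\,t^{-u_i^I}}{1-t^{-u_i^I}},$$ a polynomial in $y$ with coefficients in the field of fractions of the group ring $\mathbb Z[L^*]$ (with basis $t^u$, $u\in L^*$), and the signature of $\Delta$ is $\mathrm{Sign}(\Delta)=T_1[\Delta]$. Let $H_T^*(\Delta)$ be the face ring $\mathbb Z[x_i\mid i\in\Sigma^{(1)}]/\bigl(\prod_{i\in J}x_i \mid J\notin\Sigma\bigr)$, let $H^2_T(\Delta)$ be its part spanned over $\mathbb Z$ by the classes $x_i$, and let $c_1(\Delta)$ be the class of $\sum_i x_i$ in the quotient of $H_T^2(\Delta)$ by the subgroup $\{\sum_i\langle u,v_i\rangle x_i\mid u\in L^*\}$. If $c_1(\Delta)$ is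 divisible by $2$, then $\mathrm{Sign}(\Delta)=0$. -/

import Mathlib

open scoped TensorProduct

noncomputable section

/-- The real vector space `L_ℝ = ℝ ⊗ L` spanned by a lattice `L`. -/
abbrev RealSpan (L : Type*) [AddCommGroup L] : Type _ := ℝ ⊗[ℤ] L

/-- The image of a lattice vector in `L_ℝ`. -/
def toReal {L : Type*} [AddCommGroup L] (v : L) : RealSpan L := (1 : ℝ) ⊗ₜ[ℤ] v

/-- A lattice vector is primitive if it is non-zero and not a proper multiple of a lattice vector. -/
def IsPrimitiveVector {L : Type*} [AddCommGroup L] (v : L) : Prop :=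
  v ≠ 0 ∧ ∀ (k : ℤ) (x : L), v = k • x → IsUnit k

/-- A simplicial multi-fan `(Σ, C, w⁺, w⁻)` of dimension `n = rank L` in the lattice `L`.
`ι` is the vertex set `Σ⁽¹⁾`; a simplex with `k` vertices (an element of `Σ⁽ᵏ⁾`) is a
`k`-element `Finset ι`. Only the values of `cone` on `faces` and those of `wPos`, `wNeg` on
the `n`-element faces are ever used. -/
structure SimplicialMultiFan (ι L : Type*) [Fintype ι] [AddCommGroup L] where
  /-- the augmented (the empty simplex is included) simplicial complex `Σ` -/
  faces : Finset (Finset ι)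
  empty_mem : ∅ ∈ faces
  singleton_mem : ∀ i, {i} ∈ faces
  down_closed : ∀ I ∈ faces, ∀ J ⊆ I, J ∈ faces
  card_le : ∀ I ∈ faces, I.card ≤ Module.finrank ℤ L
  exists_top : ∃ I ∈ faces, I.card = Module.finrank ℤ L
  /-- the cones `C(I)` -/
  cone : Finset ι → PointedCone ℝ (RealSpan L)
  /-- For `I ∈ Σ⁽ᵏ⁾` the cone `C(I)` is a `k`-dimensional rational simplicial cone (hence
  strongly convex), and `J ↦ C(J)` maps the faces of `I` bijectively to the faces of `C(I)`:
  the faces of the cone over independent vectors `b i` are the cones over the subfamilies. -/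
  simplicial : ∀ I ∈ faces, ∃ b : ι → L,
    LinearIndepOn ℝ (fun i => toReal (b i)) (I : Set ι) ∧
    ∀ J ⊆ I, cone J = PointedCone.hull ℝ ((fun i => toReal (b i)) '' (J : Set ι))
  /-- the weight functions `w⁺` and `w⁻` on `Σ⁽ⁿ⁾` -/
  wPos : Finset ι → ℕ
  wNeg : Finset ι → ℕ

/-- The character lattice `L* = Hom(L, ℤ) = H²(BT)` has the unique sums property
(so that its group ring is an integral domain). -/
instance dualTwoUniqueSums (L : Type*) [AddCommGroup L] :
    TwoUniqueSums (Module.Dual ℤ L) :=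
  TwoUniqueSums.of_injective_addHom
    (⟨fun f x => f x, fun _ _ => rfl⟩ : AddHom (Module.Dual ℤ L) (L → ℤ))
    (fun _ _ h => LinearMap.ext (fun x => congrFun h x)) inferInstance

/-- The character ring `R(T) = ℤ[L*]` of the torus `T = L_ℝ / L`. -/
abbrev CharRing (L : Type*) [AddCommGroup L] : Type _ := AddMonoidAlgebra ℤ (Module.Dual ℤ L)

/-- The field of fractions of `R(T)`. -/
abbrev CharField (L : Type*) [AddCommGroup L] : Type _ := FractionRing (CharRing L)

/-- The element `t^u` for `u ∈ L*`, in the field of fractions of `R(T)`. -/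
def tPow {L : Type*} [AddCommGroup L] (u : Module.Dual ℤ L) : CharField L :=
  algebraMap (CharRing L) (CharField L) (AddMonoidAlgebra.single u 1)

/-- Every non-zero vector of a lattice is a positive multiple of a primitive one. -/
lemma exists_primitive {L : Type*} [AddCommGroup L] [Module.Free ℤ L] [Module.Finite ℤ L]
    (b : L) (hb : b ≠ 0) : ∃ (p : L) (k : ℕ), 0 < k ∧ IsPrimitiveVector p ∧ b = (k : ℤ) • p := by
  classical
  let B := Module.Free.chooseBasis ℤ L
  -- the positive integers that divide `b` are bounded
  obtain ⟨j, hj⟩ : ∃ j, B.repr b j ≠ 0 := by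
    by_contra! h
    exact hb (B.repr.injective (by ext j; simpa using h j))
  let P : ℕ → Prop := fun k => 0 < k ∧ ∃ p : L, b = (k : ℤ) • p
  have hbd : ∀ k, P k → k ≤ (B.repr b j).natAbs := by
    rintro k ⟨-, p, hp⟩
    refine Nat.le_of_dvd (Int.natAbs_pos.2 hj) ?_
    rw [← Int.natCast_dvd]
    exact ⟨B.repr p j, by rw [hp]; simp⟩
  have h1 : P 1 := ⟨one_pos, b, by simp⟩
  have hP := Nat.findGreatest_spec (P := P) (hbd 1 h1) h1
  set m := Nat.findGreatest P (B.repr b j).natAbs with hm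
  obtain ⟨hm0, p, hp⟩ := hP
  refine ⟨p, m, hm0, ⟨?_, ?_⟩, hp⟩
  · rintro rfl
    exact hb (by simpa using hp)
  · intro k x hx
    have hk0 : k ≠ 0 := by
      rintro rfl
      exact hb (by rw [hp, hx]; simp)
    have hPk : P (m * k.natAbs) := by
      refine ⟨Nat.mul_pos hm0 (Int.natAbs_pos.2 hk0), k.sign • x, ?_⟩
      rw [hp, hx, smul_smul, smul_smul]
      congr 1
      push_cast
      rw [mul_assoc, mul_comm |k|, Int.sign_mul_abs]
    have hle := Nat.le_findGreatest (hbd _ hPk) hPk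
    rw [← hm] at hle
    have : k.natAbs ≤ 1 := by
      by_contra! h
      nlinarith
    rw [Int.isUnit_iff_natAbs_eq]
    have := Int.natAbs_pos.2 hk0
    omega

namespace SimplicialMultiFan

variable {ι L : Type*} [Fintype ι] [AddCommGroup L]

/-- The set `Σ⁽ⁿ⁾` of top-dimensional simplices. -/
def top (Δ : SimplicialMultiFan ι L) : Finset (Finset ι) :=
  Δ.faces.filter (fun I => I.card = Module.finrank ℤ L)

/-- The weight `w(I) = w⁺(I) - w⁻(I)`. -/
def w (Δ : SimplicialMultiFan ι L) (I : Finset ι) : ℤ := (Δ.wPos I : ℤ) - (Δ.wNeg I : ℤ)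

/-! ### Projected multi-fans and completeness -/

/-- The linear subspace of `L_ℝ` generated by `C(K)`. -/
def coneSpan (Δ : SimplicialMultiFan ι L) (K : Finset ι) : Submodule ℝ (RealSpan L) :=
  Submodule.span ℝ (Δ.cone K : Set (RealSpan L))

/-- The space `L_ℝ / span C(K)` in which the projected multi-fan `Δ_K` lives. -/
abbrev ProjSpace (Δ : SimplicialMultiFan ι L) (K : Finset ι) : Type _ :=
  RealSpan L ⧸ Δ.coneSpan K

/-- The cone `C_K(J)` of `Δ_K`, the projection of `C(J)`, for `J ⊇ K`. -/
def projCone (Δ : SimplicialMultiFan ι L) (K J : Finset ι) : PointedCone ℝ (Δ.ProjSpace K) :=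
  PointedCone.map (Δ.coneSpan K).mkQ (Δ.cone J)

/-- A vector is generic for `Δ_K` if it lies on no linear subspace spanned by a cone `C_K(J)`,
`K ⊆ J ∈ Σ`, of less than maximal dimension `n - |K|`; here `dim C_K(J) = |J| - |K|`. -/
def IsGeneric (Δ : SimplicialMultiFan ι L) (K : Finset ι) (v : Δ.ProjSpace K) : Prop :=
  ∀ J ∈ Δ.faces, K ⊆ J → J.card < Module.finrank ℤ L →
    v ∉ Submodule.span ℝ (Δ.projCone K J : Set (Δ.ProjSpace K))

open Classical in
/-- The integer `d_v` of `Δ_K`: the sum of `w(J)` over the top-dimensional `J ⊇ K` with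
`v ∈ C_K(J)`. -/
def degreeAt (Δ : SimplicialMultiFan ι L) (K : Finset ι) (v : Δ.ProjSpace K) : ℤ :=
  ∑ J ∈ Δ.top.filter (fun J => K ⊆ J ∧ v ∈ Δ.projCone K J), Δ.w J

/-- `Δ_K` is pre-complete: `d_v` does not depend on the generic vector `v`. -/
def IsPreCompleteAt (Δ : SimplicialMultiFan ι L) (K : Finset ι) : Prop :=
  ∀ v v' : Δ.ProjSpace K, Δ.IsGeneric K v → Δ.IsGeneric K v' →
    Δ.degreeAt K v = Δ.degreeAt K v'

/-- `Δ` is complete: every projected multi-fan `Δ_K`, `K ∈ Σ`, is pre-complete (for `K = ∅`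
this is `Δ` itself). -/
def IsComplete (Δ : SimplicialMultiFan ι L) : Prop :=
  ∀ K ∈ Δ.faces, Δ.IsPreCompleteAt K

/-! ### Edge vectors and non-singularity -/

section Edge

variable [Module.Free ℤ L] [Module.Finite ℤ L]

lemma exists_edge (Δ : SimplicialMultiFan ι L) (i : ι) :
    ∃ v : L, IsPrimitiveVector v ∧ Δ.cone {i} = PointedCone.hull ℝ {toReal v} := by
  obtain ⟨b, hli, hc⟩ := Δ.simplicial {i} (Δ.singleton_mem i)
  have hb : b i ≠ 0 := by
    intro h
    have := hli.ne_zero (i := i) (by simp)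
    exact this (by simp [toReal, h])
  obtain ⟨p, k, hk, hp, hbp⟩ := exists_primitive (b i) hb
  refine ⟨p, hp, ?_⟩
  have hkr : (0 : ℝ) < k := by exact_mod_cast hk
  have h2 : toReal (b i) = (k : ℝ) • toReal p := by
    rw [hbp]
    simp only [toReal, TensorProduct.smul_tmul', smul_eq_mul, mul_one]
    rw [TensorProduct.tmul_smul, TensorProduct.smul_tmul']
    simp
  rw [hc {i} subset_rfl, Finset.coe_singleton, Set.image_singleton, h2]
  apply le_antisymm
  · refine Submodule.span_le.2 ?_
    rw [Set.singleton_subset_iff]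
    exact PointedCone.smul_mem _ hkr.le (Submodule.subset_span rfl)
  · refine Submodule.span_le.2 ?_
    rw [Set.singleton_subset_iff]
    have := PointedCone.smul_mem (PointedCone.hull ℝ {(k : ℝ) • toReal p})
      (inv_pos.2 hkr).le (Submodule.subset_span rfl)
    rwa [smul_smul, inv_mul_cancel₀ hkr.ne', one_smul] at this

/-- The (unique) primitive vector `v_i ∈ L` that generates the ray `C(i)`. -/
def edge (Δ : SimplicialMultiFan ι L) (i : ι) : L := (Δ.exists_edge i).choose

lemma edge_primitive (Δ : SimplicialMultiFan ι L) (i : ι) : IsPrimitiveVector (Δ.edge i) :=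
  (Δ.exists_edge i).choose_spec.1

lemma cone_singleton (Δ : SimplicialMultiFan ι L) (i : ι) :
    Δ.cone {i} = PointedCone.hull ℝ {toReal (Δ.edge i)} :=
  (Δ.exists_edge i).choose_spec.2

/-- `Δ` is non-singular: for every `I ∈ Σ⁽ⁿ⁾` the vectors `v_i`, `i ∈ I`, form a basis of `L`. -/
def IsNonSingular (Δ : SimplicialMultiFan ι L) : Prop :=
  ∀ I ∈ Δ.top, ∃ b : Module.Basis {i // i ∈ I} ℤ L, ∀ i, b i = Δ.edge i

/-- The basis `{v_i}_{i ∈ I}` of `L`, for `I ∈ Σ⁽ⁿ⁾`. -/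
def IsNonSingular.basis {Δ : SimplicialMultiFan ι L} (h : Δ.IsNonSingular)
    (I : {I // I ∈ Δ.top}) : Module.Basis {i // i ∈ I.1} ℤ L :=
  (h I.1 I.2).choose

lemma IsNonSingular.basis_apply {Δ : SimplicialMultiFan ι L} (h : Δ.IsNonSingular)
    (I : {I // I ∈ Δ.top}) (i : {i // i ∈ I.1}) : h.basis I i = Δ.edge i :=
  (h I.1 I.2).choose_spec i

/-- The dual basis `{u_i^I}_{i ∈ I}` of `L*`, for `I ∈ Σ⁽ⁿ⁾`. -/
def IsNonSingular.dualVec {Δ : SimplicialMultiFan ι L} (h : Δ.IsNonSingular)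
    (I : {I // I ∈ Δ.top}) (i : {i // i ∈ I.1}) : Module.Dual ℤ L :=
  (h.basis I).coord i

/-! ### The `T_y`-genus and the signature -/

/-- The `T_y`-genus `∑_{I ∈ Σ⁽ⁿ⁾} w(I) ∏_{i ∈ I} (1 + y t^{-u_i^I}) / (1 - t^{-u_i^I})` of a
non-singular multi-fan, a polynomial in the variable `y` (written `X`) with coefficients in the
field of fractions of `R(T)`. -/
def tyGenus (Δ : SimplicialMultiFan ι L) (h : Δ.IsNonSingular) : Polynomial (CharField L) :=
  ∑ I : {I // I ∈ Δ.top}, (Δ.w I.1 : Polynomial (CharField L)) *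
    ∏ i : {i // i ∈ I.1},
      ((1 + Polynomial.X * Polynomial.C (tPow (-h.dualVec I i))) *
        Polynomial.C (1 - tPow (-h.dualVec I i))⁻¹)

/-- The signature `Sign(Δ)`: the `T_y`-genus for `y = 1`. -/
def signature (Δ : SimplicialMultiFan ι L) (h : Δ.IsNonSingular) : CharField L :=
  (Δ.tyGenus h).eval 1

/-! ### Equivariant cohomology and the first Chern class -/

/-- The ideal of `ℤ[x_i]` generated by the monomials `∏_{i ∈ J} x_i` with `J ∉ Σ`. -/
def faceIdeal (Δ : SimplicialMultiFan ι L) : Ideal (MvPolynomial ι ℤ) :=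
  Ideal.span {p | ∃ J : Finset ι, J ∉ Δ.faces ∧ p = ∏ i ∈ J, MvPolynomial.X i}

/-- The equivariant cohomology ring `H_T^*(Δ)`, i.e. the face ring of `Σ`. -/
abbrev FaceRing (Δ : SimplicialMultiFan ι L) : Type _ := MvPolynomial ι ℤ ⧸ Δ.faceIdeal

/-- The class `x_i ∈ H_T^*(Δ)`. -/
def xClass (Δ : SimplicialMultiFan ι L) (i : ι) : Δ.FaceRing :=
  Ideal.Quotient.mk Δ.faceIdeal (MvPolynomial.X i)

/-- `H_T^2(Δ)`: the part of the face ring spanned by the `x_i`. -/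
def H2T (Δ : SimplicialMultiFan ι L) : Submodule ℤ Δ.FaceRing :=
  Submodule.span ℤ (Set.range Δ.xClass)

/-- The map `H²(BT) = L* → H_T^2(Δ)`, `u ↦ ∑ i, ⟨u, v_i⟩ x_i`. -/
def fromBT (Δ : SimplicialMultiFan ι L) : Module.Dual ℤ L →ₗ[ℤ] Δ.H2T where
  toFun u := ∑ i, u (Δ.edge i) • ⟨Δ.xClass i, Submodule.subset_span ⟨i, rfl⟩⟩
  map_add' u u' := by simp [add_smul, Finset.sum_add_distrib]
  map_smul' k u := by simp [mul_smul, Finset.smul_sum]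

/-- The equivariant first Chern class `c₁ᵀ(Δ) = ∑ i, x_i ∈ H_T^2(Δ)`. -/
def c1T (Δ : SimplicialMultiFan ι L) : Δ.H2T :=
  ∑ i, ⟨Δ.xClass i, Submodule.subset_span ⟨i, rfl⟩⟩

/-- The first Chern class `c₁(Δ)`, the image of `c₁ᵀ(Δ)` in `H_T^2(Δ) / H²(BT)`. -/
def c1 (Δ : SimplicialMultiFan ι L) : Δ.H2T ⧸ LinearMap.range Δ.fromBT :=
  (LinearMap.range Δ.fromBT).mkQ Δ.c1T

end Edge

end SimplicialMultiFan

end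

/-! Fix a generic lattice vector x. It fixes a direction of expansion for every factor (1 + t^{-u})
/ (1 - t^{-u}), so the I-th summand of the signature becomes a function on L*, and Sign(Δ) a formal
series whose coefficients are integer sums over Σ⁽ⁿ⁾. Expansions in different directions cannot be
multiplied, so they are treated as elements of a ℤ[L*]-module of functions;
`sum_div_eq_zero_of_module_relation` carries the vanishing of their sum back to the fraction field.

Each coefficient is an integer combination of the degrees of the projected multi-fans
(`sum_prod_sign_sub`), so by completeness it does not depend on x. For a non-zero exponent, x can be
moved into a suitable open half-space, where every summand vanishes. Only the constant ∑ w(I) ∏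
sign⟨u_i^I, x⟩ remains.

Divisibility of c₁ gives u ∈ L* that is odd on all v_i. For large N the degree at x - N p is the
same for all p ∈ L. Difference operators in the directions v_i turn this into an identity in ℤ[L]: ∑
w(I) t^{-q_I} ∏_{i ∉ I} (1 - t^{v_i}) = 0. The character t^b ↦ (-1)^{u(b)} sends it to a power of 2
times the remaining constant, which is therefore zero. -/

/-- The group ring `ℤ[A]` acts on functions `A → ℤ` by translations. -/
noncomputable def translationAction (A : Type*) [AddCommGroup A] :
    AddMonoidAlgebra ℤ A →ₐ[ℤ] Module.End ℤ (A → ℤ) :=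
  AddMonoidAlgebra.lift ℤ (Module.End ℤ (A → ℤ)) A
    { toFun := fun b => LinearMap.funLeft ℤ ℤ (fun a => a + b.toAdd)
      map_one' := by ext F a; simp [LinearMap.funLeft_apply]
      map_mul' := fun b c => by
        ext F a
        simp [LinearMap.funLeft_apply, add_assoc] }

/-! ### Functions as formal series over a group ring -/

section Translation

variable {A : Type*} [AddCommGroup A]

lemma translationAction_single (b : A) (c : ℤ) (F : A → ℤ) (a : A) :
    translationAction A (AddMonoidAlgebra.single b c) F a = c * F (a + b) := by
  simp [translationAction, AddMonoidAlgebra.lift_single, LinearMap.funLeft_apply]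

lemma translationAction_one_add_single (b : A) (c : ℤ) (F : A → ℤ) (a : A) :
    translationAction A (1 + AddMonoidAlgebra.single b c) F a = F a + c * F (a + b) := by
  rw [map_add, LinearMap.add_apply, Pi.add_apply, translationAction_single, map_one,
    Module.End.one_apply]

open Classical in
lemma translationAction_indicator (r : AddMonoidAlgebra ℤ A) (a p : A) :
    translationAction A r (fun x => if x = p then 1 else 0) a = r.coeff (p - a) := by
  induction r using AddMonoidAlgebra.induction_linear with
  | zero => simp
  | add f g hf hg => simp [hf, hg]
  | single b c =>
    rw [translationAction_single, AddMonoidAlgebra.coeff_single, Finsupp.single_apply]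
    have : a + b = p ↔ b = p - a := by rw [eq_sub_iff_add_eq, add_comm]
    simp [this]

open Classical in
-- If F stands for the series ∑ F(a) t^{-a}, the action is multiplication and the indicator of 0 is
-- the series 1, so nothing is lost by acting on it.
lemma eq_zero_of_translationAction_indicator (r : AddMonoidAlgebra ℤ A)
    (h : translationAction A r (fun x => if x = 0 then 1 else 0) = 0) : r = 0 := by
  ext a
  have := congrFun h (-a)
  rw [translationAction_indicator] at this
  simpa using this

/-- Difference operators in dual directions act factor by factor on a product of functions of the
coordinates. -/
lemma translationAction_prod {κ : Type*} (s : Finset κ) (b : κ → A) (c : κ → A → ℤ)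
    (f : κ → ℤ → ℤ) (α : ℤ)
    (hself : ∀ i ∈ s, ∀ a, c i (a + b i) = c i a + 1)
    (hne : ∀ i ∈ s, ∀ j ∈ s, i ≠ j → ∀ a, c i (a + b j) = c i a) (g : A → ℤ)
    (hg : ∀ i ∈ s, ∀ a, g (a + b i) = g a) :
    translationAction A (∏ i ∈ s, (1 + AddMonoidAlgebra.single (b i) α))
      (fun a => g a * ∏ i ∈ s, f i (c i a)) =
    fun a => g a * ∏ i ∈ s, (f i (c i a) + α * f i (c i a + 1)) := by
  classical
  induction s using Finset.induction_on generalizing g with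
  | empty => simp
  | insert j s hj ih =>
    -- The factor of `j` is invariant under the other translations, so it is absorbed into `g`.
    have key := ih (fun i hi => hself i (Finset.mem_insert_of_mem hi))
      (fun i hi k hk => hne i (Finset.mem_insert_of_mem hi) k (Finset.mem_insert_of_mem hk))
      (fun a => g a * f j (c j a)) (fun i hi a => by
        have hij : j ≠ i := fun h => hj (h ▸ hi)
        rw [hg i (Finset.mem_insert_of_mem hi), hne j (Finset.mem_insert_self _ _) i
          (Finset.mem_insert_of_mem hi) hij])
    have e : (fun a => g a * ∏ i ∈ insert j s, f i (c i a)) =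
        fun a => g a * f j (c j a) * ∏ i ∈ s, f i (c i a) := by
      funext a; rw [Finset.prod_insert hj, mul_assoc]
    rw [Finset.prod_insert hj, map_mul, Module.End.mul_apply, e, key]
    funext a
    rw [translationAction_one_add_single, Finset.prod_insert hj,
      hg j (Finset.mem_insert_self _ _), hself j (Finset.mem_insert_self _ _)]
    have : ∏ i ∈ s, (f i (c i (a + b j)) + α * f i (c i (a + b j) + 1)) =
        ∏ i ∈ s, (f i (c i a) + α * f i (c i a + 1)) := by
      refine Finset.prod_congr rfl fun i hi => ?_
      rw [hne i (Finset.mem_insert_of_mem hi) j (Finset.mem_insert_self _ _)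
        (fun h => hj (h ▸ hi))]
    rw [this]; ring

end Translation

/-- Each `F i` acts as an expansion of `N i / D i` applied to `m`. Multiplying the relation by all
denominators gives an element of `R` annihilating `m`, hence zero; this is the numerator of the sum
of fractions. -/
lemma sum_div_eq_zero_of_module_relation {R K M κ : Type*} [CommRing R] [IsDomain R] [Field K]
    [Algebra R K] [IsFractionRing R K] [AddCommGroup M] (ρ : R →+* Module.End ℤ M) (m : M)
    (hm : ∀ r, ρ r m = 0 → r = 0) (s : Finset κ) (w : κ → ℤ) (N D : κ → R) (F : κ → M)
    (hD : ∀ i ∈ s, D i ≠ 0) (hF : ∀ i ∈ s, ρ (D i) (F i) = ρ (N i) m)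
    (hsum : ∑ i ∈ s, w i • F i = 0) :
    ∑ i ∈ s, (w i : K) * (algebraMap R K (N i) / algebraMap R K (D i)) = 0 := by
  classical
  have hne : ∀ i ∈ s, algebraMap R K (D i) ≠ 0 := fun i hi h =>
    hD i hi ((IsFractionRing.injective R K) (by rw [h, map_zero]))
  have hr : ∑ i ∈ s, (w i : R) * (N i * ∏ j ∈ s.erase i, D j) = 0 := by
    apply hm
    rw [map_sum, LinearMap.sum_apply]
    trans ρ (∏ j ∈ s, D j) (∑ i ∈ s, w i • F i)
    · rw [map_sum]
      refine Finset.sum_congr rfl fun i hi => ?_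
      rw [map_smul, map_mul ρ (w i : R), Module.End.mul_apply, map_intCast,
        Module.End.intCast_apply, ← Finset.mul_prod_erase s D hi, mul_comm (D i),
        mul_comm (N i), map_mul, map_mul, Module.End.mul_apply, Module.End.mul_apply, hF i hi]
    · rw [hsum, map_zero]
  have hprod : algebraMap R K (∏ j ∈ s, D j) ≠ 0 := by
    rw [map_prod]; exact Finset.prod_ne_zero_iff.2 hne
  refine (mul_eq_zero.1 ?_).resolve_left hprod
  rw [← map_zero (algebraMap R K), ← hr, map_sum, Finset.mul_sum]
  refine Finset.sum_congr rfl fun i hi => ?_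
  rw [← Finset.mul_prod_erase s D hi]
  have := hne i hi
  simp only [map_mul, map_intCast]
  field_simp

/-- Finitely many non-zero integral functionals are simultaneously non-zero somewhere. -/
lemma exists_forall_dual_ne_zero {L κ : Type*} [AddCommGroup L] (s : Finset κ)
    (ℓ : κ → Module.Dual ℤ L) (h : ∀ k ∈ s, ℓ k ≠ 0) : ∃ x, ∀ k ∈ s, ℓ k x ≠ 0 := by
  classical
  induction s using Finset.induction_on with
  | empty => exact ⟨0, by simp⟩
  | insert j s hj ih =>
    obtain ⟨x, hx⟩ := ih fun k hk => h k (Finset.mem_insert_of_mem hk)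
    obtain ⟨y, hy⟩ : ∃ y, ℓ j y ≠ 0 := by
      by_contra! hc
      exact h j (Finset.mem_insert_self _ _) (LinearMap.ext hc)
    by_cases hjx : ℓ j x = 0
    -- The values to avoid are the integral roots of `m * ℓ k x + ℓ k y`; at such a root the integer
    -- quotient is exact.
    · obtain ⟨m, hm⟩ := Infinite.exists_notMem_finset
        (s.image fun k => (-ℓ k y) / ℓ k x)
      refine ⟨m • x + y, fun k hk => ?_⟩
      rcases Finset.mem_insert.1 hk with rfl | hk
      · simpa [hjx] using hy
      · intro h0
        refine hm (Finset.mem_image.2 ⟨k, hk, ?_⟩)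
        simp only [map_add, map_smul, smul_eq_mul] at h0
        exact Int.ediv_eq_of_eq_mul_left (hx k hk) (by linarith)
    · exact ⟨x, fun k hk => (Finset.mem_insert.1 hk).elim (fun e => e ▸ hjx) (hx k)⟩

/-! ### Dual coordinates and projected cones -/

namespace SimplicialMultiFan

variable {ι L : Type*} [Fintype ι] [AddCommGroup L] {Δ : SimplicialMultiFan ι L}

lemma mem_faces_of_mem_top {I : Finset ι} (hI : I ∈ Δ.top) : I ∈ Δ.faces :=
  (Finset.mem_filter.1 hI).1

lemma card_of_mem_top {I : Finset ι} (hI : I ∈ Δ.top) : I.card = Module.finrank ℤ L :=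
  (Finset.mem_filter.1 hI).2

lemma exists_mem_top (Δ : SimplicialMultiFan ι L) : ∃ I, I ∈ Δ.top := by
  obtain ⟨I, h1, h2⟩ := Δ.exists_top
  exact ⟨I, Finset.mem_filter.2 ⟨h1, h2⟩⟩

lemma span_hull (s : Set (RealSpan L)) :
    Submodule.span ℝ (PointedCone.hull ℝ s : Set (RealSpan L)) = Submodule.span ℝ s :=
  le_antisymm (Submodule.span_le.2 (PointedCone.hull_le_span (R := ℝ) s))
    (Submodule.span_mono PointedCone.subset_hull)

/-- The `ℝ`-linear extension of an integral functional. -/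
noncomputable def realDual (ℓ : Module.Dual ℤ L) : RealSpan L →ₗ[ℝ] ℝ :=
  Module.Dual.baseChange ℝ ℓ

lemma realDual_toReal (ℓ : Module.Dual ℤ L) (x : L) : realDual ℓ (toReal x) = (ℓ x : ℝ) := by
  simp [realDual, toReal, Module.Dual.baseChange_apply_tmul]

lemma toReal_sum_smul {κ : Type*} (s : Finset κ) (c : κ → ℤ) (v : κ → L) :
    toReal (∑ i ∈ s, c i • v i) = ∑ i ∈ s, (c i : ℝ) • toReal (v i) := by
  simp only [toReal, TensorProduct.tmul_sum, TensorProduct.smul_tmul']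
  refine Finset.sum_congr rfl fun i _ => ?_
  rw [TensorProduct.tmul_smul, TensorProduct.smul_tmul', zsmul_eq_mul, smul_eq_mul]

variable [Module.Free ℤ L] [Module.Finite ℤ L]

open Classical in
/-- The functional `u_i^I`, extended by zero to all vertices `i`. -/
noncomputable def IsNonSingular.coord {Δ : SimplicialMultiFan ι L} (h : Δ.IsNonSingular)
    (I : {I // I ∈ Δ.top}) (i : ι) : Module.Dual ℤ L :=
  if hi : i ∈ I.1 then h.dualVec I ⟨i, hi⟩ else 0

lemma IsNonSingular.coord_coe (h : Δ.IsNonSingular) (I : {I // I ∈ Δ.top})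
    (i : {i // i ∈ I.1}) : h.coord I i = h.dualVec I i := by
  simp [IsNonSingular.coord]

open Classical in
lemma IsNonSingular.coord_edge (h : Δ.IsNonSingular) (I : {I // I ∈ Δ.top}) {i j : ι}
    (hi : i ∈ I.1) (hj : j ∈ I.1) : h.coord I i (Δ.edge j) = if i = j then 1 else 0 := by
  rw [h.coord_coe I ⟨i, hi⟩, ← h.basis_apply I ⟨j, hj⟩, IsNonSingular.dualVec,
    Module.Basis.coord_apply, Module.Basis.repr_self, Finsupp.single_apply]
  simp [eq_comm]

lemma IsNonSingular.sum_coord (h : Δ.IsNonSingular) (I : {I // I ∈ Δ.top}) (x : L) :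
    ∑ i ∈ I.1, h.coord I i x • Δ.edge i = x := by
  rw [← Finset.sum_coe_sort]
  conv_rhs => rw [← (h.basis I).sum_repr x]
  exact Finset.sum_congr rfl fun i _ => by
    rw [h.coord_coe, h.basis_apply, IsNonSingular.dualVec, Module.Basis.coord_apply]

lemma IsNonSingular.dual_apply (h : Δ.IsNonSingular) (I : {I // I ∈ Δ.top})
    (a : Module.Dual ℤ L) (x : L) :
    a x = ∑ i ∈ I.1, h.coord I i x * a (Δ.edge i) := by
  conv_lhs => rw [← h.sum_coord I x]
  simp [map_sum]

lemma IsNonSingular.eq_zero_of_apply_edge (h : Δ.IsNonSingular) (I : {I // I ∈ Δ.top})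
    (a : Module.Dual ℤ L) (ha : ∀ i ∈ I.1, a (Δ.edge i) = 0) : a = 0 := by
  ext x
  rw [h.dual_apply I a x]
  exact Finset.sum_eq_zero fun i hi => by rw [ha i hi, mul_zero]

/-- Every cone of a multi-fan is generated by its edge vectors. -/
lemma cone_eq_hull_edge {J : Finset ι} (hJ : J ∈ Δ.faces) :
    Δ.cone J = PointedCone.hull ℝ ((fun i => toReal (Δ.edge i)) '' (J : Set ι)) := by
  obtain ⟨b, -, hb⟩ := Δ.simplicial J hJ
  -- The generators `b` depend on `J`, but each one spans the ray `C({i})`, which is also spanned by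
  -- the edge vector.
  have hsingle : ∀ i ∈ J, PointedCone.hull ℝ {toReal (b i)} =
      PointedCone.hull ℝ {toReal (Δ.edge i)} := fun i hi => by
    rw [← Δ.cone_singleton, hb {i} (by simpa using hi)]
    simp
  have key : ∀ f : ι → RealSpan L, PointedCone.hull ℝ (f '' (J : Set ι)) =
      ⨆ i ∈ J, PointedCone.hull ℝ {f i} := fun f => by
    rw [← Set.biUnion_of_singleton (f '' (J : Set ι)), Set.biUnion_image]
    simp only [PointedCone.hull, Submodule.span_iUnion, Finset.mem_coe]
  rw [hb J subset_rfl, key, key]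
  exact iSup_congr fun i => iSup_congr fun hi => hsingle i hi

lemma coneSpan_eq {K : Finset ι} (hK : K ∈ Δ.faces) :
    Δ.coneSpan K = Submodule.span ℝ ((fun i => toReal (Δ.edge i)) '' (K : Set ι)) := by
  rw [coneSpan, cone_eq_hull_edge hK, span_hull]

/-- Membership of a lattice vector in a projected top-dimensional cone, in coordinates. -/
lemma IsNonSingular.mem_projCone_iff (h : Δ.IsNonSingular) (I : {I // I ∈ Δ.top}) {K : Finset ι}
    (hK : K ⊆ I.1) (x : L) :
    (Δ.coneSpan K).mkQ (toReal x) ∈ Δ.projCone K I.1 ↔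
      ∀ i ∈ I.1, i ∉ K → 0 ≤ h.coord I i x := by
  classical
  have hI := mem_faces_of_mem_top I.2
  have hKf := Δ.down_closed _ hI K hK
  have hval : ∀ i ∈ I.1, ∀ j ∈ I.1, realDual (h.coord I i) (toReal (Δ.edge j)) =
      if i = j then 1 else 0 := fun i hi j hj => by
    rw [realDual_toReal, h.coord_edge I hi hj]; split <;> simp
  constructor
  · rintro ⟨c, hc, hcx⟩ i hi hiK
    have hnonneg : ∀ y ∈ PointedCone.hull ℝ ((fun i => toReal (Δ.edge i)) '' (I.1 : Set ι)),
        0 ≤ realDual (h.coord I i) y := fun y hy => by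
      induction hy using Submodule.span_induction with
      | mem y hy =>
        obtain ⟨j, hj, rfl⟩ := hy
        simp only [hval i hi j hj]
        split <;> simp
      | zero => simp
      | add y z _ _ hy hz =>
        rw [map_add]
        exact add_nonneg hy hz
      | smul r y _ hy =>
        change 0 ≤ realDual (h.coord I i) ((r : ℝ) • y)
        rw [map_smul, smul_eq_mul]
        exact mul_nonneg r.2 hy
    have h1 : 0 ≤ realDual (h.coord I i) c := hnonneg c (cone_eq_hull_edge hI ▸ hc)
    have h2 : toReal x - c ∈ Δ.coneSpan K := by
      rw [← Submodule.Quotient.mk_eq_zero, Submodule.Quotient.mk_sub, sub_eq_zero]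
      exact hcx.symm
    have h3 : Δ.coneSpan K ≤ LinearMap.ker (realDual (h.coord I i)) := by
      rw [coneSpan_eq hKf, Submodule.span_le]
      rintro _ ⟨j, hj, rfl⟩
      have hij : i ≠ j := fun e => hiK (e ▸ hj)
      simp [hval i hi j (hK hj), hij]
    have h4 := h3 h2
    rw [LinearMap.mem_ker, map_sub, sub_eq_zero, realDual_toReal] at h4
    rw [← h4] at h1
    exact_mod_cast h1
  · intro hx
    refine ⟨∑ i ∈ I.1 \ K, (h.coord I i x : ℝ) • toReal (Δ.edge i), ?_, ?_⟩
    · change _ ∈ Δ.cone I.1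
      rw [cone_eq_hull_edge hI]
      refine Submodule.sum_mem _ fun i hi => ?_
      rw [Finset.mem_sdiff] at hi
      exact PointedCone.smul_mem _ (by exact_mod_cast hx i hi.1 hi.2)
        (Submodule.subset_span ⟨i, hi.1, rfl⟩)
    · change (Δ.coneSpan K).mkQ _ = _
      conv_rhs => rw [← h.sum_coord I x, toReal_sum_smul, ← Finset.sum_sdiff hK, map_add]
      symm
      rw [add_eq_left, Submodule.mkQ_apply, Submodule.Quotient.mk_eq_zero, coneSpan_eq hKf]
      exact Submodule.sum_mem _ fun i hi =>
        Submodule.smul_mem _ _ (Submodule.subset_span ⟨i, hi, rfl⟩)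

/-! ### Generic lattice vectors -/

/-- A lattice vector is generic if it can be separated by integral functionals from the span of
every simplex of less than maximal dimension. -/
def IsGenericLattice (Δ : SimplicialMultiFan ι L) (x : L) : Prop :=
  ∀ J ∈ Δ.faces, J.card < Module.finrank ℤ L →
    ∃ ℓ : Module.Dual ℤ L, (∀ j ∈ J, ℓ (Δ.edge j) = 0) ∧ ℓ x ≠ 0

/-- As span C(K) ⊆ span C(J), a vector mapping into span C_K(J) already lies in span C(J); hence one
condition on `x` serves all `K`. -/
lemma IsGenericLattice.isGeneric {x : L} (hx : Δ.IsGenericLattice x) {K : Finset ι} :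
    Δ.IsGeneric K ((Δ.coneSpan K).mkQ (toReal x)) := by
  intro J hJ hKJ hcard hmem
  obtain ⟨ℓ, hℓ, hℓx⟩ := hx J hJ hcard
  have hle : Δ.coneSpan J ≤ LinearMap.ker (realDual ℓ) := by
    rw [coneSpan_eq hJ, Submodule.span_le]
    rintro _ ⟨j, hj, rfl⟩
    simp [realDual_toReal, hℓ j hj]
  have hKle : Δ.coneSpan K ≤ Δ.coneSpan J := by
    rw [coneSpan_eq hJ, coneSpan_eq (Δ.down_closed J hJ K hKJ)]
    exact Submodule.span_mono (Set.image_mono (by exact_mod_cast hKJ))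
  have hsp : Submodule.span ℝ (Δ.projCone K J : Set (Δ.ProjSpace K)) ≤
      (Δ.coneSpan J).map (Δ.coneSpan K).mkQ := by
    rw [Submodule.span_le]
    rintro _ ⟨y, hy, rfl⟩
    exact ⟨y, Submodule.subset_span hy, rfl⟩
  obtain ⟨y, hy, hyx⟩ := hsp hmem
  have h2 : toReal x - y ∈ Δ.coneSpan K := by
    rw [← Submodule.Quotient.mk_eq_zero, Submodule.Quotient.mk_sub, sub_eq_zero]
    exact hyx.symm
  have h3 : toReal x ∈ Δ.coneSpan J := by
    have := add_mem (hKle h2) hy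
    rwa [sub_add_cancel] at this
  have h4 := hle h3
  rw [LinearMap.mem_ker, realDual_toReal] at h4
  exact hℓx (by exact_mod_cast h4)

/-- A functional vanishing on the facet I \ {i} is a multiple of u_i^I. -/
lemma IsGenericLattice.coord_ne_zero {x : L} (hx : Δ.IsGenericLattice x) (h : Δ.IsNonSingular)
    (I : {I // I ∈ Δ.top}) {i : ι} (hi : i ∈ I.1) : h.coord I i x ≠ 0 := by
  classical
  obtain ⟨ℓ, hℓ, hℓx⟩ := hx (I.1.erase i)
    (Δ.down_closed _ (mem_faces_of_mem_top I.2) _ (Finset.erase_subset _ _))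
    (by rw [← card_of_mem_top I.2]; exact Finset.card_erase_lt_of_mem hi)
  intro h0
  apply hℓx
  rw [h.dual_apply I ℓ x]
  refine Finset.sum_eq_zero fun j hj => ?_
  by_cases hji : j = i
  · rw [hji, h0, zero_mul]
  · rw [hℓ j (Finset.mem_erase.2 ⟨hji, hj⟩), mul_zero]

/-- A simplex of less than maximal dimension is annihilated by a non-zero integral functional. -/
lemma exists_dual_ne_zero (Δ : SimplicialMultiFan ι L) (J : Finset ι)
    (hJ : J.card < Module.finrank ℤ L) :
    ∃ ℓ : Module.Dual ℤ L, ℓ ≠ 0 ∧ ∀ j ∈ J, ℓ (Δ.edge j) = 0 := by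
  let f : Module.Dual ℤ L →ₗ[ℤ] ({j // j ∈ J} → ℤ) :=
    LinearMap.pi fun j => Module.Dual.eval ℤ L (Δ.edge j)
  have hf : ¬ Function.Injective f := fun hf => by
    have := LinearMap.finrank_le_finrank_of_injective hf
    rw [Module.finrank_linearMap_self] at this
    simp at this
    omega
  rw [← LinearMap.ker_eq_bot, Submodule.eq_bot_iff] at hf
  push Not at hf
  obtain ⟨ℓ, hℓ, hne⟩ := hf
  exact ⟨ℓ, hne, fun j hj => congrFun (LinearMap.mem_ker.1 hℓ) ⟨j, hj⟩⟩

/-- Generic lattice vectors exist in every open half-space. -/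
lemma exists_isGenericLattice (Δ : SimplicialMultiFan ι L) (a : Module.Dual ℤ L) (ha : a ≠ 0) :
    ∃ x, Δ.IsGenericLattice x ∧ 0 < a x := by
  classical
  have hex : ∀ J : Finset ι, ∃ ℓ : Module.Dual ℤ L, ℓ ≠ 0 ∧
      (J.card < Module.finrank ℤ L → ∀ j ∈ J, ℓ (Δ.edge j) = 0) := fun J => by
    by_cases hJ : J.card < Module.finrank ℤ L
    · obtain ⟨ℓ, h1, h2⟩ := Δ.exists_dual_ne_zero J hJ
      exact ⟨ℓ, h1, fun _ => h2⟩
    · exact ⟨a, ha, fun h => absurd h hJ⟩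
  choose ℓ hℓ0 hℓ using hex
  obtain ⟨x, hx⟩ := exists_forall_dual_ne_zero (Finset.univ : Finset (Option (Finset ι)))
    (fun o => o.elim a ℓ) (by rintro (_ | J) - <;> simp [ha, hℓ0])
  have hgen : Δ.IsGenericLattice x := fun J _ hc =>
    ⟨ℓ J, hℓ J hc, by simpa using hx (some J) (Finset.mem_univ _)⟩
  have hax : a x ≠ 0 := by simpa using hx none (Finset.mem_univ _)
  rcases lt_or_gt_of_ne hax with hlt | hgt
  · refine ⟨-x, fun J hJ hc => ?_, by simpa using hlt⟩
    obtain ⟨ℓ, h1, h2⟩ := hgen J hJ hc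
    exact ⟨ℓ, h1, by simpa using h2⟩
  · exact ⟨x, hgen, hgt⟩

/-- Sufficiently small multiples of a generic vector are generic with respect to all lattice
translates. -/
lemma IsGenericLattice.exists_nsmul_sub {x : L} (hx : Δ.IsGenericLattice x)
    (s : Finset (Module.Dual ℤ L)) :
    ∃ N : ℤ, 0 < N ∧ (∀ p, Δ.IsGenericLattice (x - N • p)) ∧ ∀ ℓ ∈ s, |ℓ x| < N := by
  classical
  have hex : ∀ J : Finset ι, ∃ ℓ : Module.Dual ℤ L, J ∈ Δ.faces → J.card < Module.finrank ℤ L →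
      (∀ j ∈ J, ℓ (Δ.edge j) = 0) ∧ ℓ x ≠ 0 := fun J => by
    by_cases hJ : J ∈ Δ.faces ∧ J.card < Module.finrank ℤ L
    · obtain ⟨ℓ, h⟩ := hx J hJ.1 hJ.2
      exact ⟨ℓ, fun _ _ => h⟩
    · exact ⟨0, fun h1 h2 => absurd ⟨h1, h2⟩ hJ⟩
  choose ℓ hℓ using hex
  have hlt : ∀ m ∈ s ∪ Finset.univ.image ℓ,
      |m x| < 1 + ∑ m ∈ s ∪ Finset.univ.image ℓ, |m x| := fun m hm => by
    have := Finset.single_le_sum (f := fun m : Module.Dual ℤ L => |m x|)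
      (fun m _ => abs_nonneg _) hm
    lia
  refine ⟨1 + ∑ m ∈ s ∪ Finset.univ.image ℓ, |m x|, ?_, fun p J hJ hc => ?_,
    fun m hm => hlt m (Finset.mem_union_left _ hm)⟩
  · have : 0 ≤ ∑ m ∈ s ∪ Finset.univ.image ℓ, |m x| :=
      Finset.sum_nonneg fun _ _ => abs_nonneg _
    omega
  · obtain ⟨h1, h2⟩ := hℓ J hJ hc
    -- If `ℓ J` vanished at `x - N • p`, then `N` would divide `ℓ J x`, whose absolute value is less
    -- than `N`.
    refine ⟨ℓ J, h1, fun h0 => h2 ?_⟩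
    rw [map_sub, map_smul, sub_eq_zero, smul_eq_mul] at h0
    exact Int.eq_zero_of_abs_lt_dvd ⟨_, h0⟩
      (hlt _ (Finset.mem_union_right _ (Finset.mem_image_of_mem _ (Finset.mem_univ _))))

end SimplicialMultiFan

/-! ### Signs of integers -/

lemma zpow_finset_sum {G κ : Type*} [CommGroup G] (g : G) (s : Finset κ) (f : κ → ℤ) :
    g ^ ∑ i ∈ s, f i = ∏ i ∈ s, g ^ f i := by
  classical
  induction s using Finset.induction_on with
  | empty => simp
  | insert j s hj ih => rw [Finset.sum_insert hj, Finset.prod_insert hj, zpow_add, ih]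

lemma Int.sign_eq_neg_one_add {k : ℤ} (hk : k ≠ 0) :
    k.sign = -1 + (if 0 ≤ k then 2 else 0) := by
  rcases lt_or_gt_of_ne hk with h | h
  · rw [Int.sign_eq_neg_one_of_neg h, if_neg (by omega)]; rfl
  · rw [Int.sign_eq_one_of_pos h, if_pos h.le]; rfl

/-- The one-variable expansion: in one coordinate, any constant minus the sign function, multiplied
by the denominator, gives the numerator. -/
lemma Int.sign_add_one_sub_sign (k : ℤ) :
    (k + 1).sign - k.sign = (if k = 0 then 1 else 0) + (if k + 1 = 0 then 1 else 0) := by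
  rcases lt_trichotomy k 0 with h | rfl | h
  · rcases eq_or_ne k (-1) with rfl | h1
    · simp
    · rw [Int.sign_eq_neg_one_of_neg h, Int.sign_eq_neg_one_of_neg (by omega),
        if_neg h.ne, if_neg (by omega)]; rfl
  · simp
  · rw [Int.sign_eq_one_of_pos h, Int.sign_eq_one_of_pos (by omega), if_neg h.ne',
      if_neg (by omega)]; rfl

/-- The bound forces the floor quotient to be 0 or -1; this is how parities become signs. -/
lemma Int.neg_one_zpow_ediv_eq_sign {k N : ℤ} (hk : k ≠ 0) (hN : |k| < N) :
    (((-1 : ℤˣ) ^ (k / N) : ℤˣ) : ℤ) = k.sign := by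
  rw [abs_lt] at hN
  rcases lt_or_gt_of_ne hk with h | h
  · have : k / N = -1 := by
      rw [Int.ediv_eq_iff_of_pos (by omega)]
      constructor <;> linarith
    rw [this, Int.sign_eq_neg_one_of_neg h]; simp
  · rw [Int.ediv_eq_zero_of_lt h.le hN.2, Int.sign_eq_one_of_pos h]; simp

/-! ### Coefficients of the expanded signature -/

namespace SimplicialMultiFan

variable {ι L : Type*} [Fintype ι] [AddCommGroup L] {Δ : SimplicialMultiFan ι L}

/-- The homomorphism `H_T^*(Δ) → ℤ` with `x_i ↦ 1` and `x_j ↦ 0` for `j ≠ i`. -/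
noncomputable def evalVertex (Δ : SimplicialMultiFan ι L) [DecidableEq ι] (i : ι) :
    Δ.FaceRing →+* ℤ :=
  Ideal.Quotient.lift Δ.faceIdeal
    (MvPolynomial.aeval (fun j => if j = i then (1 : ℤ) else 0)).toRingHom (by
      have hle : Δ.faceIdeal ≤ RingHom.ker
          (MvPolynomial.aeval (R := ℤ) (fun j => if j = i then (1 : ℤ) else 0)).toRingHom := by
        rw [faceIdeal, Ideal.span_le]
        rintro _ ⟨J, hJ, rfl⟩
        -- A non-face cannot be contained in the face {i}.
        obtain ⟨j, hj, hji⟩ : ∃ j ∈ J, j ≠ i := by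
          by_contra! hc
          exact hJ (Δ.down_closed {i} (Δ.singleton_mem i) J fun j hj => by simp [hc j hj])
        simp only [SetLike.mem_coe, RingHom.mem_ker, map_prod]
        exact Finset.prod_eq_zero hj (by simp [hji])
      exact fun p hp => hle hp)

lemma evalVertex_xClass [DecidableEq ι] (i j : ι) :
    Δ.evalVertex i (Δ.xClass j) = if j = i then 1 else 0 := by
  simp [evalVertex, xClass]

variable [Module.Free ℤ L] [Module.Finite ℤ L]

open Classical in
lemma IsNonSingular.degreeAt_eq (h : Δ.IsNonSingular) (K : Finset ι) (x : L) :
    Δ.degreeAt K ((Δ.coneSpan K).mkQ (toReal x)) = ∑ I : {I // I ∈ Δ.top},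
      if K ⊆ I.1 then (if ∀ i ∈ I.1 \ K, 0 ≤ h.coord I i x then Δ.w I.1 else 0) else 0 := by
  rw [degreeAt, Finset.sum_filter, ← Finset.sum_coe_sort]
  refine Finset.sum_congr rfl fun I _ => ?_
  by_cases hK : K ⊆ I.1
  · rw [if_pos hK]
    congr 1
    rw [h.mem_projCone_iff I hK]
    simp [hK]
  · simp [hK]

/-- The products of shifted signs of coordinates, summed with weights, are linear combinations of
the degrees of the projected multi-fans. -/
lemma IsNonSingular.sum_prod_sign_sub (h : Δ.IsNonSingular) {x : L} (hx : Δ.IsGenericLattice x)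
    (c : ι → ℤ) :
    ∑ I : {I // I ∈ Δ.top}, Δ.w I.1 * ∏ i ∈ I.1, ((h.coord I i x).sign - c i) =
      ∑ K ∈ Δ.faces, (∏ i ∈ K, (-1 - c i)) * 2 ^ (Module.finrank ℤ L - K.card) *
        Δ.degreeAt K ((Δ.coneSpan K).mkQ (toReal x)) := by
  classical
  simp only [h.degreeAt_eq, Finset.mul_sum]
  rw [Finset.sum_comm]
  refine Finset.sum_congr rfl fun I _ => ?_
  have e1 : ∏ i ∈ I.1, ((h.coord I i x).sign - c i) =
      ∏ i ∈ I.1, ((-1 - c i) + if 0 ≤ h.coord I i x then 2 else 0) :=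
    Finset.prod_congr rfl fun i hi => by
      rw [Int.sign_eq_neg_one_add (hx.coord_ne_zero h I hi)]; ring
  have e2 : I.1.powerset = Δ.faces.filter (fun K => K ⊆ I.1) := by
    ext K
    simp only [Finset.mem_powerset, Finset.mem_filter]
    exact ⟨fun hK => ⟨Δ.down_closed _ (mem_faces_of_mem_top I.2) K hK, hK⟩, fun hK => hK.2⟩
  -- `K` collects the vertices contributing `-1 - c i`; the other factors are non-zero exactly when
  -- x projects into C_K(I).
  rw [e1, Finset.prod_add, e2, Finset.mul_sum, Finset.sum_filter]
  refine Finset.sum_congr rfl fun K _ => ?_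
  by_cases hK : K ⊆ I.1
  · rw [if_pos hK, if_pos hK, Finset.prod_ite_zero, Finset.prod_const,
      Finset.card_sdiff_of_subset hK, card_of_mem_top I.2]
    split_ifs <;> ring
  · simp [hK]

lemma IsNonSingular.sum_prod_sign_sub_congr (h : Δ.IsNonSingular) (hΔ : Δ.IsComplete) {x x' : L}
    (hx : Δ.IsGenericLattice x) (hx' : Δ.IsGenericLattice x') (c : ι → ℤ) :
    ∑ I : {I // I ∈ Δ.top}, Δ.w I.1 * ∏ i ∈ I.1, ((h.coord I i x).sign - c i) =
      ∑ I : {I // I ∈ Δ.top}, Δ.w I.1 * ∏ i ∈ I.1, ((h.coord I i x').sign - c i) := by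
  rw [h.sum_prod_sign_sub hx, h.sum_prod_sign_sub hx']
  exact Finset.sum_congr rfl fun K hK => by
    rw [hΔ K hK _ _ hx.isGeneric hx'.isGeneric]

/-- The sums below are the non-constant coefficients of the expansion of the signature. -/
lemma IsNonSingular.sum_prod_sign_sub_sign_eq_zero (h : Δ.IsNonSingular) (hΔ : Δ.IsComplete)
    {x : L} (hx : Δ.IsGenericLattice x) {a : Module.Dual ℤ L} (ha : a ≠ 0) :
    ∑ I : {I // I ∈ Δ.top}, Δ.w I.1 *
      ∏ i ∈ I.1, ((h.coord I i x).sign - (a (Δ.edge i)).sign) = 0 := by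
  obtain ⟨y, hy, hay⟩ := Δ.exists_isGenericLattice a ha
  rw [h.sum_prod_sign_sub_congr hΔ hx hy]
  refine Finset.sum_eq_zero fun I _ => mul_eq_zero_of_right _ ?_
  rw [h.dual_apply I a y] at hay
  -- A positive sum ∑ ⟨u_i^I, y⟩ ⟨a, v_i⟩ has a positive term; its two factors have equal signs,
  -- which kills the product for `I`.
  obtain ⟨i, hi, hpos⟩ := Finset.exists_lt_of_sum_lt (f := fun _ => (0 : ℤ)) (by simpa using hay)
  refine Finset.prod_eq_zero hi ?_
  rcases pos_and_pos_or_neg_and_neg_of_mul_pos hpos with ⟨h1, h2⟩ | ⟨h1, h2⟩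
  · rw [Int.sign_eq_one_of_pos h1, Int.sign_eq_one_of_pos h2]; rfl
  · rw [Int.sign_eq_neg_one_of_neg h1, Int.sign_eq_neg_one_of_neg h2]; rfl

/-- If some character is odd on all edge vectors, then the constant coefficient of the expansion of
the signature vanishes. -/
lemma IsNonSingular.sum_prod_sign_eq_zero (h : Δ.IsNonSingular) (hΔ : Δ.IsComplete) [Nonempty ι]
    (u : Module.Dual ℤ L) (hu : ∀ i, Odd (u (Δ.edge i))) {x : L} (hx : Δ.IsGenericLattice x) :
    ∑ I : {I // I ∈ Δ.top}, Δ.w I.1 * ∏ i ∈ I.1, (h.coord I i x).sign = 0 := by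
  classical
  obtain ⟨N, hN, hgen, hlt⟩ := hx.exists_nsmul_sub
    (Finset.univ.biUnion fun I : {I // I ∈ Δ.top} => I.1.image (h.coord I))
  replace hlt : ∀ I : {I // I ∈ Δ.top}, ∀ i ∈ I.1, |h.coord I i x| < N := fun I i hi =>
    hlt _ (Finset.mem_biUnion.2 ⟨I, Finset.mem_univ _, Finset.mem_image_of_mem _ hi⟩)
  -- the characteristic functions of the lattice points `p` with `x - N p` in the cone of `I`
  let F : {I // I ∈ Δ.top} → L → ℤ := fun I p =>
    ∏ i ∈ I.1, if h.coord I i p ≤ h.coord I i x / N then 1 else 0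
  -- Rounding x/N down in the basis of `I` gives the apex of the region on which `F I` is 1.
  let q : {I // I ∈ Δ.top} → L := fun I => ∑ i ∈ I.1, (h.coord I i x / N) • Δ.edge i
  let D : ι → AddMonoidAlgebra ℤ L := fun i => 1 + AddMonoidAlgebra.single (Δ.edge i) (-1)
  have hq : ∀ I : {I // I ∈ Δ.top}, ∀ i ∈ I.1, h.coord I i (q I) = h.coord I i x / N :=
    fun I i hi => by
      simp only [q, map_sum, map_smul, smul_eq_mul]
      rw [Finset.sum_congr rfl fun j hj => by rw [h.coord_edge I hi hj]]
      simp [hi]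
  -- Every `x - N • p` is generic, so completeness makes the weighted sum constant on all of `L`.
  have hdeg : ∀ p, ∑ I, Δ.w I.1 * F I p = Δ.degreeAt ∅ ((Δ.coneSpan ∅).mkQ (toReal x)) :=
    fun p => by
      rw [hΔ ∅ Δ.empty_mem _ _ hx.isGeneric (hgen p).isGeneric, h.degreeAt_eq]
      refine Finset.sum_congr rfl fun I _ => ?_
      have : ∀ i, h.coord I i p ≤ h.coord I i x / N ↔ 0 ≤ h.coord I i (x - N • p) := fun i => by
        rw [Int.le_ediv_iff_mul_le hN, map_sub, map_smul, smul_eq_mul, sub_nonneg, mul_comm]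
      simp only [F, this, Finset.prod_ite_zero, Finset.prod_const_one, Finset.sdiff_empty,
        Finset.empty_subset, if_true]
      split_ifs <;> simp
  have hF : ∀ I, translationAction L (∏ i ∈ I.1, D i) (F I) =
      translationAction L (AddMonoidAlgebra.single (-q I) 1) (fun a => if a = 0 then 1 else 0) :=
    fun I => by
      have := translationAction_prod I.1 Δ.edge (fun i => h.coord I i)
        (fun i k => if k ≤ h.coord I i x / N then 1 else 0) (-1)
        (fun i hi a => by rw [map_add, h.coord_edge I hi hi, if_pos rfl])
        (fun i hi j hj hij a => by rw [map_add, h.coord_edge I hi hj, if_neg hij, add_zero])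
        (fun _ => 1) (fun _ _ _ => rfl)
      simp only [one_mul] at this
      refine this.trans (funext fun p => ?_)
      rw [translationAction_single, one_mul, ← sub_eq_add_neg]
      have e : ∀ i ∈ I.1, ((if h.coord I i p ≤ h.coord I i x / N then 1 else 0) +
          -1 * (if h.coord I i p + 1 ≤ h.coord I i x / N then 1 else 0) : ℤ) =
          if h.coord I i (p - q I) = 0 then 1 else 0 := fun i hi => by
        rw [map_sub, hq I i hi]
        split_ifs <;> omega
      rw [Finset.prod_congr rfl e, Finset.prod_ite_zero, Finset.prod_const_one]
      congr 1
      rw [eq_iff_iff]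
      refine ⟨fun h0 => ?_, fun h0 i _ => by rw [h0, map_zero]⟩
      rw [← h.sum_coord I (p - q I)]
      exact Finset.sum_eq_zero fun i hi => by rw [h0 i hi, zero_smul]
  have hconst : ∀ d : ℤ, translationAction L (∏ i, D i) (fun _ => d) = 0 := fun d => by
    obtain ⟨i⟩ := ‹Nonempty ι›
    rw [← Finset.prod_erase_mul _ _ (Finset.mem_univ i), map_mul, Module.End.mul_apply]
    have : translationAction L (D i) (fun _ => d) = 0 := by
      funext p
      rw [translationAction_one_add_single]
      simp
    rw [this, map_zero]
  -- Apply the product of all `D i` to that constant: it kills the constant, while the factors with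
  -- i ∈ I reduce `F I` to the indicator of its apex.
  have hR : ∑ I : {I // I ∈ Δ.top}, Δ.w I.1 •
      ((∏ i ∈ Finset.univ \ I.1, D i) * AddMonoidAlgebra.single (-q I) 1) = 0 := by
    apply eq_zero_of_translationAction_indicator
    have e : (∑ I, Δ.w I.1 • F I) =
        fun _ => Δ.degreeAt ∅ ((Δ.coneSpan ∅).mkQ (toReal x)) := by
      funext p
      rw [← hdeg p]
      simp
    rw [← hconst (Δ.degreeAt ∅ ((Δ.coneSpan ∅).mkQ (toReal x))), ← e, map_sum, map_sum,
      LinearMap.sum_apply]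
    refine Finset.sum_congr rfl fun I _ => ?_
    rw [map_smul, map_smul, LinearMap.smul_apply, map_mul, Module.End.mul_apply, ← hF,
      ← Module.End.mul_apply, ← map_mul, Finset.prod_sdiff (Finset.subset_univ _)]
  -- Oddness of `u` sends t^{v_i} to -1, so no factor 1 - t^{v_i} vanishes under this character.
  let χ : AddMonoidAlgebra ℤ L →ₐ[ℤ] ℤ := AddMonoidAlgebra.lift ℤ ℤ L
    { toFun := fun b => (((-1 : ℤˣ) ^ u b.toAdd : ℤˣ) : ℤ)
      map_one' := by simp
      map_mul' := fun b c => by simp [zpow_add] }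
  have hχ : ∀ (b : L) (c : ℤ), χ (AddMonoidAlgebra.single b c) =
      c * (((-1 : ℤˣ) ^ u b : ℤˣ) : ℤ) := fun b c => by
    simp [χ, AddMonoidAlgebra.lift_single]
  have hχD : ∀ i, χ (D i) = 2 := fun i => by
    rw [map_add, map_one, hχ, (hu i).neg_one_zpow]; rfl
  have hχq : ∀ I : {I // I ∈ Δ.top}, χ (AddMonoidAlgebra.single (-q I) 1) =
      ∏ i ∈ I.1, (h.coord I i x).sign := fun I => by
    rw [hχ, one_mul, map_neg, zpow_neg, Int.units_inv_eq_self]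
    have : (-1 : ℤˣ) ^ u (q I) = ∏ i ∈ I.1, (-1 : ℤˣ) ^ (h.coord I i x / N) := by
      simp only [q, map_sum, map_smul, smul_eq_mul]
      rw [zpow_finset_sum]
      refine Finset.prod_congr rfl fun i _ => ?_
      rw [mul_comm, zpow_mul, (hu i).neg_one_zpow]
    rw [this, Units.coe_prod]
    exact Finset.prod_congr rfl fun i hi =>
      Int.neg_one_zpow_ediv_eq_sign (hx.coord_ne_zero h I hi) (hlt I i hi)
  have hfin := congrArg χ hR
  rw [map_sum, map_zero] at hfin
  -- All top simplices have `n` vertices, so the power of 2 is the same for each and can be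
  -- cancelled.
  have e : ∀ I : {I // I ∈ Δ.top}, χ (Δ.w I.1 •
      ((∏ i ∈ Finset.univ \ I.1, D i) * AddMonoidAlgebra.single (-q I) 1)) =
      2 ^ (Fintype.card ι - Module.finrank ℤ L) *
        (Δ.w I.1 * ∏ i ∈ I.1, (h.coord I i x).sign) := fun I => by
    rw [map_smul, map_mul, map_prod, hχq, Finset.prod_congr rfl fun i _ => hχD i,
      Finset.prod_const, Finset.card_sdiff_of_subset (Finset.subset_univ _), Finset.card_univ,
      card_of_mem_top I.2, smul_eq_mul]
    ring
  rw [Finset.sum_congr rfl fun I _ => e I, ← Finset.mul_sum] at hfin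
  exact (mul_eq_zero.1 hfin).resolve_left (by positivity)

/-! ### Parity from the first Chern class, and the conclusion -/

/-- If `c₁(Δ)` is divisible by two, then some character is odd on all edge vectors. -/
lemma exists_dual_odd (hc1 : ∃ x : Δ.H2T ⧸ LinearMap.range Δ.fromBT, Δ.c1 = (2 : ℤ) • x) :
    ∃ u : Module.Dual ℤ L, ∀ i, Odd (u (Δ.edge i)) := by
  classical
  obtain ⟨x, hx⟩ := hc1
  obtain ⟨y, rfl⟩ := Submodule.mkQ_surjective _ x
  rw [c1, ← map_smul, ← sub_eq_zero, ← map_sub, Submodule.mkQ_apply,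
    Submodule.Quotient.mk_eq_zero] at hx
  obtain ⟨u, hu⟩ := hx
  refine ⟨u, fun i => ?_⟩
  -- Reading off the coefficient of x_i gives u(v_i) = 1 - 2 y_i.
  have h1 := congrArg (fun z : Δ.H2T => Δ.evalVertex i z) hu
  have h2 : Δ.evalVertex i (Δ.fromBT u : Δ.FaceRing) = u (Δ.edge i) := by
    simp [fromBT, evalVertex_xClass]
  have h3 : Δ.evalVertex i (Δ.c1T : Δ.FaceRing) = 1 := by
    simp [c1T, evalVertex_xClass]
  simp only [h2, Submodule.coe_sub, map_sub, h3, Submodule.coe_smul, map_zsmul] at h1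
  rw [h1, smul_eq_mul]
  exact ⟨-Δ.evalVertex i y, by ring⟩

lemma signature_eq (h : Δ.IsNonSingular) :
    Δ.signature h = ∑ I : {I // I ∈ Δ.top}, (Δ.w I.1 : CharField L) *
      (algebraMap (CharRing L) (CharField L)
          (∏ i ∈ I.1, (1 + AddMonoidAlgebra.single (-h.coord I i) 1)) /
        algebraMap (CharRing L) (CharField L)
          (∏ i ∈ I.1, (1 + AddMonoidAlgebra.single (-h.coord I i) (-1)))) := by
  rw [signature, tyGenus, Polynomial.eval_finsetSum]
  refine Finset.sum_congr rfl fun I _ => ?_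
  rw [Polynomial.eval_mul, Polynomial.eval_intCast, Polynomial.eval_prod, map_prod, map_prod,
    ← Finset.prod_div_distrib, ← Finset.prod_coe_sort I.1]
  congr 1
  refine Finset.prod_congr rfl fun i _ => ?_
  rw [h.coord_coe]
  simp [tPow, div_eq_mul_inv, AddMonoidAlgebra.single_neg, sub_eq_add_neg]

end SimplicialMultiFan

/-- The signature (the `T_y`-genus for `y = 1`) of a complete non-singular multi-fan `Δ` of positive
dimension with `c₁(Δ) ≡ 0 mod 2` vanishes. -/
theorem mainTheorem9 {ι L : Type*} [Fintype ι] [AddCommGroup L] [Module.Free ℤ L]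
    [Module.Finite ℤ L] (hn : 1 ≤ Module.finrank ℤ L)
    (Δ : SimplicialMultiFan ι L) (hcomplete : Δ.IsComplete) (hns : Δ.IsNonSingular)
    (hc1 : ∃ x : Δ.H2T ⧸ LinearMap.range Δ.fromBT, Δ.c1 = (2 : ℤ) • x) :
    Δ.signature hns = 0 := by
  classical
  obtain ⟨u, hu⟩ := SimplicialMultiFan.exists_dual_odd hc1
  obtain ⟨I₀, hI₀⟩ := Δ.exists_mem_top
  -- Positive rank supplies a vertex: it makes `u` non-zero and provides a factor 1 - t^{v_i} that
  -- kills constants.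
  obtain ⟨i₀, hi₀⟩ : I₀.Nonempty := by
    rw [← Finset.card_pos, SimplicialMultiFan.card_of_mem_top hI₀]; exact hn
  have : Nonempty ι := ⟨i₀⟩
  have hu0 : u ≠ 0 := fun h0 => by
    have := hu i₀
    simp [h0] at this
  obtain ⟨x, hx, -⟩ := Δ.exists_isGenericLattice u hu0
  have hself : ∀ I : {I // I ∈ Δ.top}, ∀ i ∈ I.1, ∀ a : Module.Dual ℤ L,
      -(a + -hns.coord I i) (Δ.edge i) = -a (Δ.edge i) + 1 := fun I i hi a => by
    rw [LinearMap.add_apply, LinearMap.neg_apply, hns.coord_edge I hi hi, if_pos rfl]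
    ring
  have hother : ∀ I : {I // I ∈ Δ.top}, ∀ i ∈ I.1, ∀ j ∈ I.1, i ≠ j → ∀ a : Module.Dual ℤ L,
      -(a + -hns.coord I j) (Δ.edge i) = -a (Δ.edge i) := fun I i hi j hj hij a => by
    simp [hns.coord_edge I hj hi, hij.symm]
  rw [SimplicialMultiFan.signature_eq]
  refine sum_div_eq_zero_of_module_relation
    (translationAction (Module.Dual ℤ L)).toRingHom (fun a => if a = 0 then 1 else 0)
    eq_zero_of_translationAction_indicator _ _ _ _
    -- A factor is expanded as 1 + 2t^{-u} + 2t^{-2u} + ⋯ if ⟨u, x⟩ > 0, and as -1 - 2t^u - 2t^{2u}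
    -- - ⋯ if ⟨u, x⟩ < 0.
    (fun I a => ∏ i ∈ I.1, ((hns.coord I i x).sign - (-a (Δ.edge i)).sign)) ?_ ?_ ?_
  · intro I _
    refine Finset.prod_ne_zero_iff.2 fun i hi h0 => ?_
    have hne : hns.coord I i ≠ 0 := fun h1 => by
      simpa [h1] using hns.coord_edge I hi hi
    -- Since u_i^I ≠ 0, the coefficient of 1 - t^{-u_i^I} at 0 is 1.
    have := congrArg (fun r : CharRing L => r.coeff 0) h0
    simp [AddMonoidAlgebra.one_def, AddMonoidAlgebra.coeff_single, hne] at this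
  · intro I _
    have h1 := translationAction_prod I.1 (fun i => -hns.coord I i)
      (fun i (a : Module.Dual ℤ L) => -a (Δ.edge i))
      (fun i k => (hns.coord I i x).sign - k.sign) (-1) (hself I) (hother I)
      (fun _ => 1) (fun _ _ _ => rfl)
    have h2 := translationAction_prod I.1 (fun i => -hns.coord I i)
      (fun i (a : Module.Dual ℤ L) => -a (Δ.edge i))
      (fun i k => if k = 0 then 1 else 0) 1 (hself I) (hother I)
      (fun _ => 1) (fun _ _ _ => rfl)
    simp only [one_mul] at h1 h2
    have h3 : (fun a : Module.Dual ℤ L => ∏ i ∈ I.1, if -a (Δ.edge i) = 0 then (1 : ℤ) else 0) =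
        fun a => if a = 0 then 1 else 0 := by
      funext a
      rw [Finset.prod_ite_zero, Finset.prod_const_one]
      congr 1
      rw [eq_iff_iff]
      exact ⟨fun h0 => hns.eq_zero_of_apply_edge I a fun i hi => by simpa using h0 i hi,
        fun h0 i _ => by simp [h0]⟩
    rw [h3] at h2
    refine h1.trans (Eq.trans (funext fun a => Finset.prod_congr rfl fun i _ => ?_) h2.symm)
    rw [← Int.sign_add_one_sub_sign]
    ring
  · funext a
    simp only [Finset.sum_apply, Pi.smul_apply, smul_eq_mul, Pi.zero_apply]
    by_cases ha : a = 0
    · simpa [ha] using hns.sum_prod_sign_eq_zero hcomplete u hu hx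
    · exact hns.sum_prod_sign_sub_sign_eq_zero hcomplete hx (a := -a) (neg_ne_zero.2 ha)
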